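/- A group is called meta-Nil-Hamiltonian if each of its non-nilpotent subgroups is normal. Let $G$ be a finitely generated non-nilpotent meta-Nil-Hamiltonian group, and let $H \le G$ be a nilpotent subgroup of finite index. Then $G$ is soluble and its commutator subgroup $G'$ is finite. -/

import Mathlib

/-- A group `G` is meta-Nil-Hamiltonian if each of its non-nilpotent subgroups is normal. -/
def IsMetaNilHamiltonian (G : Type*) [Group G] : Prop :=
  ∀ K : Subgroup G, ¬ Group.IsNilpotent K → K.Normal

/-!
# Finitely generated virtually nilpotent meta-Nil-Hamiltonian groups

*Solubility.* Passing to the quotient by a nilpotent normal subgroup of finite index, it suffices to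
treat finite groups (`isSolvable_of_finite`). A minimal counterexample is simple, so its proper
non-nilpotent subgroups, being normal, do not exist. Schmidt's argument excludes this
(`isNilpotent_of_isSimpleGroup`): distinct maximal subgroups meet trivially, and the conjugates of
two non-conjugate ones contain too many elements.

*Finiteness of `G'`.* The group satisfies the maximal condition on subgroups, so it has a maximal
finite normal subgroup `F`, and `G / F` has no nontrivial finite normal subgroup. The quotient
`G / F` is nilpotent (`isNilpotent_of_noFiniteNormal`). The point is that an element `x` acting with
finite order on a torsion-free abelian normal subgroup `A` acts trivially
(`IsMetaNilHamiltonian.commute_of_pow_commute`). Indeed, either some `⟨x⟩ A ^ n` is nilpotent, so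
that `x` acts unipotently, or all of them are normal and `[A, x]` is contained in each of them,
which again forces `x` to act unipotently. Thus the centre of a nilpotent normal subgroup of finite
index is central, and one inducts on the central quotient.

It remains to pass from `G / F` to `G` (`IsMetaNilHamiltonian.finite_commutator`). If `K` is a
non-nilpotent subgroup, all subgroups of `G / K` are normal, so `(G / K)'` is finite; hence `G'` is
finite if such a `K` is finite. Otherwise `F` is nilpotent, and as `G` is not, some `x` acts
non-unipotently on `F` (`isNilpotent_of_engel`). The same holds for `x z` whenever `z` centralizes
`F`, so each `⟨x z⟩ F` is an infinite normal subgroup. An infinite normal cyclic subgroup of a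
nilpotent group is central, so a subgroup of finite index is central in `G / F`, and `G'` is finite
by Schur's theorem.
-/

namespace MetaNilHamiltonian

open Subgroup

open scoped commutatorElement

/-! ### Iterated commutators -/

section Engel

variable {G : Type*} [Group G]

/-- The map `a ↦ [a⁻¹, x] = a⁻¹ · (x a x⁻¹)`. On an abelian normal subgroup, written additively, it
is the endomorphism `θ - 1`, where `θ` is conjugation by `x`. -/
def commMap (x a : G) : G := ⁅a⁻¹, x⁆

theorem commMap_eq (x a : G) : commMap x a = a⁻¹ * (x * a * x⁻¹) := by
  simp [commMap, commutatorElement_def, mul_assoc]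

@[simp] theorem commMap_one (x : G) : commMap x 1 = 1 := by simp [commMap_eq]

theorem commMap_eq_one_iff {x a : G} : commMap x a = 1 ↔ x * a = a * x := by
  rw [commMap_eq, inv_mul_eq_one, eq_mul_inv_iff_mul_eq, eq_comm]

theorem commMap_mem {A : Subgroup G} [A.Normal] (x : G) {a : G} (ha : a ∈ A) :
    commMap x a ∈ A := by
  rw [commMap_eq]
  exact A.mul_mem (A.inv_mem ha) (Normal.conj_mem ‹_› a ha x)

theorem iterate_commMap_mem {A : Subgroup G} [A.Normal] (x : G) {a : G} (ha : a ∈ A) (k : ℕ) :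
    (commMap x)^[k] a ∈ A := by
  induction k with
  | zero => simpa
  | succ k ih => rw [Function.iterate_succ_apply']; exact commMap_mem x ih

theorem iterate_commMap_mem_lowerCentralSeries {K : Subgroup G} {x a : G} (hx : x ∈ K)
    (ha : a ∈ K) (k : ℕ) : (commMap x)^[k] a ∈ K.lowerCentralSeries k := by
  induction k with
  | zero => simpa
  | succ k ih =>
    rw [Function.iterate_succ_apply', Subgroup.lowerCentralSeries_succ]
    exact commutator_mem_commutator (inv_mem ih) hx

theorem exists_iterate_commMap_eq_one {K : Subgroup G} (hK : Group.IsNilpotent K) {x a : G}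
    (hx : x ∈ K) (ha : a ∈ K) : ∃ k, (commMap x)^[k] a = 1 := by
  obtain ⟨k, hk⟩ := K.isNilpotent_iff_lowerCentralSeries.mp hK
  refine ⟨k, ?_⟩
  have := iterate_commMap_mem_lowerCentralSeries hx ha k
  rwa [hk, mem_bot] at this

/-- An element that acts on a normal subgroup `A` both with finite order dividing `m` and unipotently
acts trivially, provided that `A` has no `m`-torsion. -/
theorem commute_of_pow_commute_of_engel {A : Subgroup G} [A.Normal]
    {x : G} {m : ℕ} (hx : ∀ a ∈ A, x ^ m * a = a * x ^ m) (htor : ∀ a ∈ A, a ^ m = 1 → a = 1)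
    (hengel : ∀ a ∈ A, ∃ k, (commMap x)^[k] a = 1) {a : G} (ha : a ∈ A) : x * a = a * x := by
  have key : ∀ k, ∀ a ∈ A, (commMap x)^[k] a = 1 → commMap x a = 1 := by
    intro k
    induction k with
    | zero => rintro a - h; simp_all
    | succ k ih =>
      intro a ha h
      rw [Function.iterate_succ_apply] at h
      have hc := commMap_mem x ha
      have h1 := commMap_eq_one_iff.mp (ih _ hc h)
      apply htor _ hc
      generalize hcdef : commMap x a = c at h1 hc
      have h2 : x * a * x⁻¹ = a * c := by rw [← hcdef, commMap_eq]; group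
      -- Since `x` centralizes `c = [a⁻¹, x]`, conjugation by `x ^ j` multiplies `a` by `c ^ j`.
      have h3 : ∀ j : ℕ, x ^ j * a = a * c ^ j * x ^ j := by
        intro j
        induction j with
        | zero => simp
        | succ j ihj =>
          have h4 : x * c ^ j = c ^ j * x := (Commute.pow_right (h1 : Commute x c) j).eq
          calc x ^ (j + 1) * a = x * (x ^ j * a) := by rw [pow_succ', mul_assoc]
            _ = (x * a * x⁻¹) * (x * c ^ j) * x ^ j := by rw [ihj]; group
            _ = a * c ^ (j + 1) * x ^ (j + 1) := by rw [h2, h4, pow_succ', pow_succ']; group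
      have h5 := h3 m
      rw [hx a ha, mul_assoc, mul_right_inj, eq_comm, mul_eq_right] at h5
      exact h5
  obtain ⟨k, hk⟩ := hengel a ha
  exact commMap_eq_one_iff.mp (key k a ha hk)

end Engel

/-! ### Schur's theorem and groups all of whose cyclic subgroups are normal -/

section Schur

variable {G : Type*} [Group G]

/-- **Schur's theorem**: if the centre has finite index, the commutator subgroup is finite. -/
theorem finite_commutator_of_finiteIndex_center [(center G).FiniteIndex] :
    Finite (commutator G) := by
  have : Finite (commutatorSet G) := by
    refine Set.Finite.subset (Set.finite_range
      fun p : (G ⧸ center G) × (G ⧸ center G) => ⁅p.1.out, p.2.out⁆) ?_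
    rintro _ ⟨a, b, rfl⟩
    refine ⟨(a, b), ?_⟩
    obtain ⟨⟨z, hz⟩, h1⟩ := QuotientGroup.mk_out_eq_mul (center G) a
    obtain ⟨⟨w, hw⟩, h2⟩ := QuotientGroup.mk_out_eq_mul (center G) b
    rw [mem_center_iff] at hz hw
    simp only [h1, h2, commutatorElement_def, mul_inv_rev]
    have hz' : ∀ g, z * g = g * z := fun g => (hz g).symm
    have hw' : ∀ g, w * g = g * w := fun g => (hw g).symm
    calc a * z * (b * w) * (z⁻¹ * a⁻¹) * (w⁻¹ * b⁻¹)
        = a * (z * (b * w)) * z⁻¹ * a⁻¹ * w⁻¹ * b⁻¹ := by group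
      _ = a * b * (w * a⁻¹) * w⁻¹ * b⁻¹ := by rw [hz']; group
      _ = a * b * a⁻¹ * b⁻¹ := by rw [hw']; group
  infer_instance

/-- The automorphism group of a cyclic group is finite, also for an infinite cyclic group. -/
theorem finiteIndex_centralizer_of_normal_zpowers {x : G} (hx : (zpowers x).Normal) :
    (centralizer {x}).FiniteIndex := by
  have hfin : Finite (MulAut (zpowers x)) := by
    refine Finite.of_equiv _ (IsCyclic.mulAutMulEquiv (zpowers x)).symm.toEquiv
  let f : G →* MulAut (zpowers x) := MulAut.conjNormal
  have : f.ker.FiniteIndex := by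
    have : Finite f.range := inferInstance
    exact finiteIndex_ker f
  refine finiteIndex_of_le (H := f.ker) fun g hg => ?_
  rw [mem_centralizer_singleton_iff]
  have h := congrArg Subtype.val
    (DFunLike.congr_fun (MonoidHom.mem_ker.mp hg) ⟨x, mem_zpowers x⟩)
  rw [MulAut.conjNormal_apply] at h
  exact mul_inv_eq_iff_eq_mul.mp h

/-- The centre is the intersection of the centralizers of finitely many generators, so it has finite
index. -/
theorem finite_commutator_of_forall_normal_zpowers [hfg : Group.FG G]
    (h : ∀ x : G, (zpowers x).Normal) : Finite (commutator G) := by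
  obtain ⟨S, hS, hfin⟩ := Group.fg_iff.mp hfg
  have : (center G).FiniteIndex := by
    rw [← centralizer_univ, ← coe_top, ← hS, centralizer_closure, centralizer_eq_iInf]
    have := hfin.to_subtype
    rw [iInf_subtype']
    exact finiteIndex_iInf fun i => finiteIndex_centralizer_of_normal_zpowers (h i)
  exact finite_commutator_of_finiteIndex_center

end Schur

/-! ### The maximal condition on subgroups -/

section Noetherian

variable {G : Type*} [Group G]

/-- A group with the maximal condition on subgroups has only finitely generated subgroups. -/
theorem fg_of_wellFoundedGT [WellFoundedGT (Subgroup G)] (K : Subgroup G) : K.FG := by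
  obtain ⟨M, ⟨hMK, hM⟩, hmax⟩ := WellFounded.has_min (wellFounded_gt (α := Subgroup G))
    {M | M ≤ K ∧ M.FG} ⟨⊥, bot_le, FG.bot⟩
  suffices M = K by rwa [← this]
  refine le_antisymm hMK fun k hk => ?_
  by_contra hkM
  have hle : M ⊔ zpowers k ≤ K := sup_le hMK (by simpa)
  refine hmax (M ⊔ zpowers k) ⟨hle, hM.sup ?_⟩ (lt_of_le_of_ne le_sup_left fun h => hkM ?_)
  · exact ⟨{k}, by simp [zpowers_eq_closure]⟩
  · rw [h]; exact mem_sup_right (mem_zpowers k)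

theorem wellFoundedGT_of_surjective {H : Type*} [Group H] (f : G →* H)
    (hf : Function.Surjective f) [WellFoundedGT (Subgroup G)] : WellFoundedGT (Subgroup H) :=
  StrictMono.wellFoundedGT (f := comap f)
    (Monotone.strictMono_of_injective (fun _ _ h => comap_mono h) (comap_injective hf))

theorem wellFoundedGT_of_quotient (N : Subgroup G) [N.Normal] [WellFoundedGT (Subgroup N)]
    [WellFoundedGT (Subgroup (G ⧸ N))] : WellFoundedGT (Subgroup G) := by
  refine StrictMono.wellFoundedGT
    (f := fun K : Subgroup G => (K.subgroupOf N, K.map (QuotientGroup.mk' N))) ?_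
  intro K L hKL
  refine lt_of_le_of_ne ⟨comap_mono hKL.le, map_mono hKL.le⟩ fun h => hKL.not_ge fun l hl => ?_
  obtain ⟨h1, h2⟩ := Prod.mk.inj h
  obtain ⟨k, hk, hkl⟩ : QuotientGroup.mk' N l ∈ K.map (QuotientGroup.mk' N) :=
    h2 ▸ mem_map_of_mem _ hl
  have hN : k⁻¹ * l ∈ N := QuotientGroup.eq.mp hkl
  have h3 : (⟨k⁻¹ * l, hN⟩ : N) ∈ L.subgroupOf N := L.mul_mem (L.inv_mem (hKL.le hk)) hl
  rw [← h1] at h3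
  simpa using K.mul_mem hk h3

theorem wellFoundedGT_of_mul_comm [hfg : Group.FG G] (h : ∀ a b : G, a * b = b * a) :
    WellFoundedGT (Subgroup G) := by
  let _ : CommGroup G := { ‹Group G› with mul_comm := h }
  have : Module.Finite ℤ (Additive G) :=
    Module.Finite.iff_addGroup_fg.mpr (GroupFG.iff_add_fg.mp hfg)
  have hN : IsNoetherian ℤ (Additive G) := inferInstance
  have : WellFoundedGT (Submodule ℤ (Additive G)) := inferInstance
  exact StrictMono.wellFoundedGT (f := fun K : Subgroup G =>
    AddSubgroup.toIntSubmodule (Subgroup.toAddSubgroup K))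
    ((OrderIso.strictMono _).comp (OrderIso.strictMono _))

/-- The last nontrivial term of the lower central series is generated by the commutators of
finitely many elements, if the quotient by it satisfies the maximal condition. -/
theorem fg_lowerCentralSeries [hfg : Group.FG G] {n : ℕ}
    (hn : (⊤ : Subgroup G).lowerCentralSeries (n + 1) = ⊥)
    (hQ : WellFoundedGT (Subgroup (G ⧸ (⊤ : Subgroup G).lowerCentralSeries n))) :
    ((⊤ : Subgroup G).lowerCentralSeries n).FG := by
  obtain _ | n := n
  · exact Group.fg_def.mp hfg
  set L := (⊤ : Subgroup G).lowerCentralSeries (n + 1) with hL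
  set M := (⊤ : Subgroup G).lowerCentralSeries n with hM
  have hLM : L = ⁅M, ⊤⁆ := rfl
  have hLc : L ≤ center G := by
    intro l hl
    rw [mem_center_iff]
    intro g
    have : ⁅l, g⁆ ∈ (⊤ : Subgroup G).lowerCentralSeries (n + 2) :=
      commutator_mem_commutator hl (mem_top g)
    rw [hn, mem_bot, commutatorElement_eq_one_iff_mul_comm] at this
    exact this.symm
  obtain ⟨S, hS, hSfin⟩ := Group.fg_iff.mp hfg
  -- `U` generates `M` modulo `L`, and `T` below lifts it to `G`.
  obtain ⟨U, hU, hUfin⟩ := (fg_iff _).mp (fg_of_wellFoundedGT (M.map (QuotientGroup.mk' L)))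
  have hle : L ≤ M := (⊤ : Subgroup G).lowerCentralSeries_antitone n.le_succ
  let T : Set G := Quotient.out '' U
  have hTU : QuotientGroup.mk' L '' T = U := by
    rw [Set.image_image]
    simp
  have hMT : M ≤ closure T ⊔ L := by
    have : M.map (QuotientGroup.mk' L) = (closure T).map (QuotientGroup.mk' L) := by
      rw [MonoidHom.map_closure, hTU, hU]
    have h2 : M ≤ ((closure T).map (QuotientGroup.mk' L)).comap (QuotientGroup.mk' L) := by
      rw [← this]; exact le_comap_map _ _
    rwa [comap_map_eq, QuotientGroup.ker_mk'] at h2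
  have hTM : T ⊆ M := by
    have h2 : closure T ≤ (M.map (QuotientGroup.mk' L)).comap (QuotientGroup.mk' L) := by
      rw [← hU, ← hTU, ← MonoidHom.map_closure]; exact le_comap_map _ _
    rw [comap_map_eq, QuotientGroup.ker_mk', sup_eq_left.mpr hle] at h2
    exact (closure_le _).mp h2
  let D : Subgroup G := closure (Set.image2 (fun t s => ⁅t, s⁆) T S)
  have hDL : D ≤ L := by
    rw [closure_le]
    rintro _ ⟨t, ht, s, -, rfl⟩
    exact commutator_mem_commutator (hTM ht) (mem_top s)
  have hDn : D.Normal := ⟨fun d hd g => by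
    rw [mem_center_iff.mp (hLc (hDL hd)) g, mul_inv_cancel_right]; exact hd⟩
  refine (fg_iff _).mpr ⟨_, le_antisymm hDL ?_, (hUfin.image _).image2 _ hSfin⟩
  have hMc : M ≤ (center (G ⧸ D)).comap (QuotientGroup.mk' D) := by
    refine hMT.trans (sup_le ((closure_le _).mpr fun t ht => ?_) fun l hl => ?_)
    · have : closure S ≤ (centralizer {QuotientGroup.mk' D t}).comap (QuotientGroup.mk' D) := by
        refine (closure_le _).mpr fun s hs => ?_
        rw [SetLike.mem_coe, mem_comap, mem_centralizer_singleton_iff, eq_comm,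
          ← commutatorElement_eq_one_iff_mul_comm, ← map_commutatorElement]
        exact (QuotientGroup.eq_one_iff _).mpr (subset_closure ⟨t, ht, s, hs, rfl⟩)
      rw [SetLike.mem_coe, mem_comap, mem_center_iff]
      intro q
      obtain ⟨g, rfl⟩ := QuotientGroup.mk'_surjective D q
      have hg : g ∈ closure S := hS ▸ mem_top g
      exact mem_centralizer_singleton_iff.mp (this hg)
    · rw [mem_comap, mem_center_iff]
      intro q
      obtain ⟨g, rfl⟩ := QuotientGroup.mk'_surjective D q
      rw [← map_mul, ← map_mul, mem_center_iff.mp (hLc hl) g]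
  rw [hLM, commutator_le]
  intro m hm g _
  rw [← QuotientGroup.eq_one_iff (N := D), ← QuotientGroup.mk'_apply, map_commutatorElement,
    commutatorElement_eq_one_iff_mul_comm]
  exact (mem_center_iff.mp (mem_comap.mp (hMc hm)) _).symm

theorem wellFoundedGT_of_isNilpotent [Group.FG G] [hG : Group.IsNilpotent G] :
    WellFoundedGT (Subgroup G) := by
  obtain ⟨n, hn⟩ := Subgroup.nilpotent_iff_lowerCentralSeries.mp hG
  induction n generalizing G with
  | zero =>
    have : Subsingleton (Subgroup G) := subsingleton_of_bot_eq_top hn.symm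
    infer_instance
  | succ n ih =>
    set L := (⊤ : Subgroup G).lowerCentralSeries n with hL
    have hQ : WellFoundedGT (Subgroup (G ⧸ L)) := by
      apply ih
      rw [← map_top_of_surjective _ (QuotientGroup.mk'_surjective L), ← map_lowerCentralSeries,
        ← hL]
      exact QuotientGroup.map_mk'_self L
    have : Group.FG L := (Group.fg_iff_subgroup_fg L).mpr (fg_lowerCentralSeries hn hQ)
    have : WellFoundedGT (Subgroup L) := by
      refine wellFoundedGT_of_mul_comm fun a b => Subtype.ext ?_
      have : ⁅(a : G), (b : G)⁆ ∈ (⊤ : Subgroup G).lowerCentralSeries (n + 1) :=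
        commutator_mem_commutator a.2 (mem_top _)
      rwa [hn, mem_bot, commutatorElement_eq_one_iff_mul_comm] at this
    exact wellFoundedGT_of_quotient L

theorem wellFoundedGT_of_finiteIndex [Group.FG G] (N : Subgroup G) [N.Normal] [N.FiniteIndex]
    [Group.IsNilpotent N] : WellFoundedGT (Subgroup G) := by
  have : WellFoundedGT (Subgroup N) := wellFoundedGT_of_isNilpotent
  have : WellFoundedGT (Subgroup (G ⧸ N)) := inferInstance
  exact wellFoundedGT_of_quotient N

end Noetherian

/-! ### Finite meta-Nil-Hamiltonian groups are soluble -/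

section Finite

variable {G : Type*} [Group G]

theorem _root_.IsMetaNilHamiltonian.of_surjective {H : Type*} [Group H]
    (hG : IsMetaNilHamiltonian G) (f : G →* H) (hf : Function.Surjective f) : IsMetaNilHamiltonian H := by
  intro K hK
  have : (K.comap f).Normal := by
    refine hG _ fun h => hK ?_
    exact Group.nilpotent_of_surjective (f.subgroupComap K)
      (f.subgroupComap_surjective_of_surjective K hf)
  rw [← map_comap_eq_self_of_surjective hf K]
  exact this.map f hf

theorem isNilpotent_of_le {K L : Subgroup G} (h : K ≤ L) (hL : Group.IsNilpotent L) :
    Group.IsNilpotent K :=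
  Group.nilpotent_of_mulEquiv (subgroupOfEquivOfLe h)

theorem _root_.IsMetaNilHamiltonian.subgroup (hG : IsMetaNilHamiltonian G) (K : Subgroup G) :
    IsMetaNilHamiltonian K := by
  intro M hM
  have : (M.map K.subtype).Normal := hG _ fun h => hM <|
    (Group.isNilpotent_congr (M.equivMapOfInjective _ K.subtype_injective)).mpr h
  rw [← comap_map_eq_self_of_injective K.subtype_injective M]
  exact this.comap _

/-- In a finite simple group with nilpotent proper subgroups, distinct maximal subgroups intersect
trivially: the normalizer of a largest nontrivial intersection lies in a third maximal subgroup,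
which by the normalizer condition meets both in something larger. -/
theorem inf_eq_bot_of_isCoatom [Finite G] [IsSimpleGroup G]
    (hG : ∀ K : Subgroup G, K ≠ ⊤ → Group.IsNilpotent K) {M N : Subgroup G} (hM : IsCoatom M)
    (hN : IsCoatom N) (hMN : M ≠ N) : M ⊓ N = ⊥ := by
  by_contra hne
  obtain ⟨I, ⟨M, N, hM, hN, hMN, hI, hne⟩, hmax⟩ := WellFounded.has_min
    (wellFounded_gt (α := Subgroup G))
    {I | ∃ M N : Subgroup G, IsCoatom M ∧ IsCoatom N ∧ M ≠ N ∧ M ⊓ N = I ∧ I ≠ ⊥}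
    ⟨_, M, N, hM, hN, hMN, rfl, hne⟩
  have hIM : I ≤ M := hI ▸ inf_le_left
  have hIN : I ≤ N := hI ▸ inf_le_right
  have hIt : I ≠ ⊤ := fun h => hM.1 (top_le_iff.mp (h ▸ hIM))
  have hnorm : normalizer (I : Set G) ≠ ⊤ := fun h =>
    (IsSimpleGroup.eq_bot_or_eq_top_of_normal I (normalizer_eq_top_iff.mp h)).elim hne hIt
  obtain ⟨P, hP, hnP⟩ := (eq_top_or_exists_le_coatom _).resolve_left hnorm
  have key : ∀ A B : Subgroup G, IsCoatom A → IsCoatom B → A ≠ B → A ⊓ B = I → P = A := by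
    intro A B hA hB hAB hABI
    by_contra hPA
    have hIA : I < A := lt_of_le_of_ne (hABI ▸ inf_le_left) fun h => by
      have hle : A ≤ B := by rw [← h, ← hABI]; exact inf_le_right
      exact (hA.le_iff.mp hle).elim hB.1 (fun h => hAB h.symm)
    have hlt : I.subgroupOf A < ⊤ := by
      rw [lt_top_iff_ne_top, Ne, subgroupOf_eq_top]
      exact hIA.not_ge
    have := hG A hA.1
    have h1 := Group.normalizerCondition_of_isNilpotent (G := A) _ hlt
    obtain ⟨a, ha, haI⟩ := SetLike.exists_of_lt h1
    have haP : (a : G) ∈ P := by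
      apply hnP
      rw [mem_normalizer_iff] at ha ⊢
      intro h
      constructor
      · intro hh
        exact (ha ⟨h, hIA.le hh⟩).mp hh
      · intro hh
        have hhA : h ∈ A := by
          have := A.mul_mem (A.mul_mem (A.inv_mem a.2) (hIA.le hh)) a.2
          simpa [mul_assoc] using this
        exact (ha ⟨h, hhA⟩).mpr hh
    refine hmax (P ⊓ A) ⟨P, A, hP, hA, hPA, rfl, ?_⟩ ?_
    · intro h
      have := le_inf (le_normalizer.trans hnP) hIA.le
      rw [h, le_bot_iff] at this
      exact hne this
    · refine lt_of_le_of_ne (le_inf (le_normalizer.trans hnP) hIA.le) fun h => haI ?_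
      rw [mem_subgroupOf, h]
      exact ⟨haP, a.2⟩
  exact hMN ((key M N hM hN hMN hI).symm.trans (key N M hN hM hMN.symm (inf_comm N M ▸ hI)))

/-- A finite simple group all of whose proper subgroups are nilpotent is itself nilpotent. -/
theorem isNilpotent_of_isSimpleGroup [Finite G] [IsSimpleGroup G]
    (hG : ∀ K : Subgroup G, K ≠ ⊤ → Group.IsNilpotent K) : Group.IsNilpotent G := by
  by_contra hnil
  -- maximal subgroups are nontrivial and self-normalizing
  have hbot : ∀ M : Subgroup G, IsCoatom M → M ≠ ⊥ := by
    rintro _ hM rfl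
    obtain ⟨g, hg⟩ := exists_ne (1 : G)
    have : zpowers g = ⊤ := (hM.le_iff.mp bot_le).resolve_right fun h => hg (by simpa using h)
    have : IsCyclic G := ⟨g, (eq_top_iff' _).mp this⟩
    let _ : CommGroup G := IsCyclic.commGroup
    exact hnil inferInstance
  have hself : ∀ M : Subgroup G, IsCoatom M → normalizer (M : Set G) = M := by
    intro M hM
    refine (hM.le_iff.mp le_normalizer).resolve_left fun h => ?_
    exact (IsSimpleGroup.eq_bot_or_eq_top_of_normal M (normalizer_eq_top_iff.mp h)).elim
      (hbot M hM) hM.1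
  have hconj : ∀ M : Subgroup G, IsCoatom M → ∀ g : G,
      IsCoatom (M.map (MulAut.conj g).toMonoidHom) := by
    intro M hM g
    exact ((MulAut.conj g).mapSubgroup.isCoatom_iff M).mpr hM
  have hmem : ∀ (M : Subgroup G) (g x : G),
      x ∈ M.map (MulAut.conj g).toMonoidHom ↔ g⁻¹ * x * g ∈ M := by
    intro M g x
    constructor
    · rintro ⟨m, hm, rfl⟩
      simpa [mul_assoc] using hm
    · intro h
      exact ⟨_, h, by simp [mul_assoc]⟩
  have hTI : ∀ M : Subgroup G, IsCoatom M → ∀ L : Subgroup G, IsCoatom L → ∀ g h x : G, x ≠ 1 →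
      g⁻¹ * x * g ∈ M → h⁻¹ * x * h ∈ L →
      M.map (MulAut.conj g).toMonoidHom = L.map (MulAut.conj h).toMonoidHom := by
    intro M hM L hL g h x hx h1 h2
    by_contra hne
    have := inf_eq_bot_of_isCoatom hG (hconj M hM g) (hconj L hL h) hne
    exact hx ((mem_bot (G := G)).mp (this ▸ ⟨(hmem M g x).mpr h1, (hmem L h x).mpr h2⟩))
  -- `U M` is the set of nontrivial elements lying in some conjugate of `M`. As the conjugates of
  -- `M` are indexed by `G ⧸ M` and meet trivially, it has `|G : M| * (|M| - 1)` elements.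
  let U : Subgroup G → Set G := fun M => {x | x ≠ 1 ∧ ∃ g : G, g⁻¹ * x * g ∈ M}
  have hU : ∀ M : Subgroup G, IsCoatom M → (U M).ncard = M.index * (Nat.card M - 1) := by
    intro M hM
    let f : (G ⧸ M) × {m : M // m ≠ 1} → U M := fun p =>
      ⟨p.1.out * p.2.1 * p.1.out⁻¹, by simpa using p.2.2, p.1.out, by simp [mul_assoc]⟩
    have hf : Function.Bijective f := by
      constructor
      · rintro ⟨p, m, hm⟩ ⟨q, n, hn⟩ h
        have h1 : p.out * m * p.out⁻¹ = q.out * n * q.out⁻¹ := congrArg Subtype.val h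
        have h2 := hTI M hM M hM p.out q.out (p.out * m * p.out⁻¹) (by simpa using hm)
          (by simp [mul_assoc]) (by rw [h1]; simp [mul_assoc])
        have h3 : q.out⁻¹ * p.out ∈ normalizer (M : Set G) := by
          rw [mem_normalizer_iff]
          intro x
          have h4 := SetLike.ext_iff.mp h2 (p.out * x * p.out⁻¹)
          rw [hmem, hmem] at h4
          simpa [mul_assoc] using h4
        rw [hself M hM] at h3
        obtain rfl : q = p := by
          rw [← QuotientGroup.out_eq' q, ← QuotientGroup.out_eq' p]
          exact QuotientGroup.eq.mpr h3
        simp only [mul_left_inj, mul_right_inj, SetLike.coe_eq_coe] at h1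
        subst h1
        rfl
      · rintro ⟨x, hx, g, hg⟩
        obtain ⟨h, hh⟩ := QuotientGroup.mk_out_eq_mul M g
        refine ⟨⟨(g : G ⧸ M), ⟨h⁻¹ * ⟨_, hg⟩ * h, ?_⟩⟩, Subtype.ext ?_⟩
        · intro h1
          apply hx
          have h2 := congrArg Subtype.val h1
          simp only [Subgroup.coe_mul, Subgroup.coe_inv, Subgroup.coe_one] at h2
          rw [mul_assoc, inv_mul_eq_one, right_eq_mul, mul_assoc, inv_mul_eq_one,
            right_eq_mul] at h2
          exact h2
        · simp only [f, hh]
          simp [mul_assoc]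
    rw [← Nat.card_coe_set_eq, ← Nat.card_congr (Equiv.ofBijective f hf), Nat.card_prod, index]
    congr 1
    have h1 := Set.ncard_add_ncard_compl ({1} : Set M)
    rw [Set.ncard_singleton, ← Nat.card_coe_set_eq ({1}ᶜ : Set M)] at h1
    have h2 : Nat.card {m : M // m ≠ 1} = Nat.card (({1}ᶜ : Set M)) := rfl
    omega
  have hcard : ∀ M : Subgroup G, IsCoatom M →
      (U M).ncard + M.index = Nat.card G ∧ 2 * M.index ≤ Nat.card G := by
    intro M hM
    have h1 := M.index_mul_card
    have h2 : 1 < Nat.card M := M.one_lt_card_iff_ne_bot.mpr (hbot M hM)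
    obtain ⟨c, hc⟩ := Nat.exists_eq_add_of_lt h2
    rw [hU M hM, ← h1, hc]
    constructor
    · simp; ring
    · nlinarith
  have hone : ({1}ᶜ : Set G).ncard + 1 = Nat.card G := by
    rw [← Set.ncard_add_ncard_compl ({1} : Set G), Set.ncard_singleton, add_comm]
  have hcyc : ∀ g : G, ∃ M : Subgroup G, IsCoatom M ∧ g ∈ M := by
    intro g
    obtain h | ⟨M, hM, hgM⟩ := eq_top_or_exists_le_coatom (zpowers g)
    · have : IsCyclic G := ⟨g, (eq_top_iff' _).mp h⟩
      let _ : CommGroup G := IsCyclic.commGroup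
      exact absurd CommGroup.isNilpotent hnil
    · exact ⟨M, hM, hgM (mem_zpowers g)⟩
  obtain ⟨M, hM, -⟩ := hcyc 1
  obtain ⟨y, hy1, hyM⟩ : ∃ y : G, y ≠ 1 ∧ y ∉ U M := by
    by_contra! h
    have h1 : ({1}ᶜ : Set G).ncard ≤ (U M).ncard := Set.ncard_le_ncard fun x hx => h x hx
    have h2 : M.index ≠ 1 := fun h => hM.1 (index_eq_one.mp h)
    have h3 := index_ne_zero_of_finite (H := M)
    have := (hcard M hM).1
    omega
  obtain ⟨L, hL, hyL⟩ := hcyc y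
  have hdisj : Disjoint (U M) (U L) := by
    rw [Set.disjoint_left]
    rintro x ⟨hx, g, hg⟩ ⟨-, h, hh⟩
    have h1 := hTI M hM L hL g h x hx hg hh
    refine hyM ⟨hy1, h⁻¹ * g, ?_⟩
    have h2 := SetLike.ext_iff.mp h1 (h * y * h⁻¹)
    rw [hmem, hmem] at h2
    have h3 := h2.mpr (by simpa [mul_assoc] using hyL)
    simpa [mul_assoc] using h3
  have h1 := Set.ncard_union_eq hdisj
  have h2 : (U M ∪ U L).ncard ≤ ({1}ᶜ : Set G).ncard := by
    refine Set.ncard_le_ncard ?_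
    rintro x (hx | hx)
    · exact hx.1
    · exact hx.1
  have := hcard M hM
  have := hcard L hL
  omega

theorem isSolvable_of_finite [Finite G] (hG : IsMetaNilHamiltonian G) : Group.IsSolvable G := by
  obtain ⟨n, hn⟩ : ∃ n, Nat.card G = n := ⟨_, rfl⟩
  induction n using Nat.strong_induction_on generalizing G with
  | _ n ih =>
    by_cases hN : ∃ N : Subgroup G, N.Normal ∧ N ≠ ⊥ ∧ N ≠ ⊤
    · obtain ⟨N, hNn, hb, ht⟩ := hN
      have h1 : Group.IsSolvable N := by
        refine ih _ ?_ (hG.subgroup N) rfl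
        exact hn ▸ (lt_of_le_of_ne N.card_le_card_group fun h => ht (N.card_eq_iff_eq_top.mp h))
      have h2 : Group.IsSolvable (G ⧸ N) := by
        refine ih _ ?_ (hG.of_surjective _ (QuotientGroup.mk'_surjective N)) rfl
        rw [← hn, N.card_eq_card_quotient_mul_card_subgroup]
        exact lt_mul_of_one_lt_right Nat.card_pos (N.one_lt_card_iff_ne_bot.mpr hb)
      exact (Group.isSolvable_iff_subgroup_quotient N).mpr ⟨h1, h2⟩
    · push Not at hN
      rcases subsingleton_or_nontrivial G with h | h
      · infer_instance
      have : IsSimpleGroup G := ⟨fun N hN' => or_iff_not_imp_left.mpr (hN N hN')⟩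
      have : Group.IsNilpotent G := isNilpotent_of_isSimpleGroup fun K hK => by
        by_contra h
        have hb := (hN K (hG K h)).mt hK
        rw [not_not] at hb
        subst hb
        exact h inferInstance
      infer_instance

end Finite

/-! ### Groups without finite normal subgroups -/

section NoFiniteNormal

/-- The group `G` has no nontrivial finite normal subgroup. -/
def NoFiniteNormal (G : Type*) [Group G] : Prop :=
  ∀ N : Subgroup G, N.Normal → Finite N → N = ⊥

variable {G : Type*} [Group G]

theorem NoFiniteNormal.eq_one_of_pow_eq_one [WellFoundedGT (Subgroup G)] (hG : NoFiniteNormal G)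
    {A : Subgroup G} [hAn : A.Normal] (hA : ∀ a ∈ A, ∀ b ∈ A, a * b = b * a) {n : ℕ} (hn : n ≠ 0)
    {a : G} (ha : a ∈ A) (h : a ^ n = 1) : a = 1 := by
  let T : Subgroup G :=
    { carrier := {t | t ∈ A ∧ t ^ n = 1}
      one_mem' := ⟨one_mem _, one_pow _⟩
      mul_mem' := fun {s t} hs ht =>
        ⟨mul_mem hs.1 ht.1, by rw [Commute.mul_pow (hA s hs.1 t ht.1), hs.2, ht.2, one_mul]⟩
      inv_mem' := fun {s} hs => ⟨inv_mem hs.1, by rw [inv_pow, hs.2, inv_one]⟩ }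
  have hT : T.Normal :=
    ⟨fun t ht g => ⟨hAn.conj_mem t ht.1 g, by rw [conj_pow, ht.2, mul_one, mul_inv_cancel]⟩⟩
  have : Group.FG T := (Group.fg_iff_subgroup_fg T).mpr (fg_of_wellFoundedGT T)
  let _ : CommGroup T := { (inferInstance : Group T) with
    mul_comm := fun s t => Subtype.ext (hA s s.2.1 t t.2.1) }
  have hfin : Finite T := CommGroup.finite_of_fg_isMulTorsion (G := T) fun t =>
    isOfFinOrder_iff_pow_eq_one.mpr ⟨n, Nat.pos_of_ne_zero hn, Subtype.ext t.2.2⟩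
  have haT : a ∈ T := ⟨ha, h⟩
  rwa [hG T hT hfin, mem_bot] at haT

/-- Dividing by the centre creates no finite normal subgroups: if `E / Z(G)` is finite, then `E'`
is finite by Schur's theorem, so `E` is abelian, hence torsion-free, and some power of every element
of `E` is central. -/
theorem NoFiniteNormal.quotient_center [WellFoundedGT (Subgroup G)] (hG : NoFiniteNormal G) :
    NoFiniteNormal (G ⧸ center G) := by
  intro N hN hfin
  let E := N.comap (QuotientGroup.mk' (center G))
  have hZE : center G ≤ E := fun z hz => by
    rw [mem_comap, QuotientGroup.mk'_apply, (QuotientGroup.eq_one_iff z).mpr hz]; exact one_mem N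
  have hEn : E.Normal := hN.comap _
  have hidx : ((center G).subgroupOf E).FiniteIndex := by
    have : ((QuotientGroup.mk' (center G)).subgroupComap N).ker = (center G).subgroupOf E := by
      ext e
      rw [MonoidHom.mem_ker, mem_subgroupOf, ← QuotientGroup.eq_one_iff, Subtype.ext_iff]
      rfl
    rw [← this]
    exact finiteIndex_ker _
  have hcE : (center E).FiniteIndex := finiteIndex_of_le (H := (center G).subgroupOf E) fun e he =>
    mem_center_iff.mpr fun g => Subtype.ext (mem_center_iff.mp he g)
  have hE' := finite_commutator_of_finiteIndex_center (G := E)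
  have hbot : (commutator E).map E.subtype = ⊥ :=
    hG _ inferInstance (Finite.of_equiv _
      ((commutator E).equivMapOfInjective _ E.subtype_injective).toEquiv)
  have hcomm : ∀ a ∈ E, ∀ b ∈ E, a * b = b * a := by
    intro a ha b hb
    have : ⁅a, b⁆ ∈ (commutator E).map E.subtype :=
      ⟨⁅⟨a, ha⟩, ⟨b, hb⟩⁆, commutator_mem_commutator (mem_top _) (mem_top _), rfl⟩
    rwa [hbot, mem_bot, commutatorElement_eq_one_iff_mul_comm] at this
  have hle : E ≤ center G := by
    intro e he
    rw [mem_center_iff]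
    intro g
    obtain ⟨n, hn, -, hen⟩ := exists_pow_mem_of_index_ne_zero hidx.index_ne_zero ⟨e, he⟩
    have hen' : g * e ^ n = e ^ n * g := mem_center_iff.mp hen g
    have hc := hEn.conj_mem e he g
    have h1 : (g * e * g⁻¹ * e⁻¹) ^ n = 1 := by
      rw [Commute.mul_pow (hcomm _ hc _ (inv_mem he)), conj_pow, hen', inv_pow]
      group
    have h2 := hG.eq_one_of_pow_eq_one hcomm hn.ne' (mul_mem hc (inv_mem he)) h1
    rwa [mul_inv_eq_one, mul_inv_eq_iff_eq_mul] at h2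
  rw [eq_bot_iff]
  intro q hq
  obtain ⟨g, rfl⟩ := QuotientGroup.mk'_surjective _ q
  exact (mem_bot (G := G ⧸ center G)).mpr ((QuotientGroup.eq_one_iff g).mpr (hle hq))

theorem finite_of_finite_map {H : Type*} [Group H] (f : G →* H) [Finite f.ker] (K : Subgroup G)
    (hK : Finite (K.map f)) : Finite K := by
  have hr : (f.comp K.subtype).range = K.map f := by
    rw [MonoidHom.range_comp, range_subtype]
  refine (MonoidHom.finite_iff_finite_ker_range (f.comp K.subtype)).mpr ⟨?_, by rwa [hr]⟩
  exact Finite.of_injective (β := f.ker) (fun k => ⟨k.1, k.2⟩) fun a b h =>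
    Subtype.ext (Subtype.ext (congrArg (fun y : f.ker => (y : G)) h))

theorem exists_finite_normal_noFiniteNormal_quotient [WellFoundedGT (Subgroup G)] :
    ∃ (F : Subgroup G) (_ : F.Normal), Finite F ∧ NoFiniteNormal (G ⧸ F) := by
  obtain ⟨F, ⟨hF, hfin⟩, hmax⟩ := WellFounded.has_min (wellFounded_gt (α := Subgroup G))
    {F | F.Normal ∧ Finite F} ⟨⊥, inferInstance, inferInstance⟩
  refine ⟨F, hF, hfin, fun N hN hNfin => ?_⟩
  let E := N.comap (QuotientGroup.mk' F)
  have hFE : F ≤ E := fun z hz => by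
    rw [mem_comap, QuotientGroup.mk'_apply, (QuotientGroup.eq_one_iff z).mpr hz]
    exact one_mem N
  have hE : Finite E := by
    have hk : Finite (QuotientGroup.mk' F).ker := by rwa [QuotientGroup.ker_mk']
    refine finite_of_finite_map (QuotientGroup.mk' F) E ?_
    rwa [map_comap_eq_self_of_surjective (QuotientGroup.mk'_surjective F)]
  have hEF : E = F := by
    by_contra h
    exact hmax E ⟨hN.comap _, hE⟩ (lt_of_le_of_ne hFE (Ne.symm h))
  rw [eq_bot_iff]
  intro q hq
  obtain ⟨g, rfl⟩ := QuotientGroup.mk'_surjective _ q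
  have : g ∈ E := hq
  rw [hEF] at this
  exact (mem_bot (G := G ⧸ F)).mpr ((QuotientGroup.eq_one_iff g).mpr this)

end NoFiniteNormal

/-! ### Abelian normal subgroups of meta-Nil-Hamiltonian groups -/

section AbelianNormal

variable {G : Type*} [Group G]

/-- The subgroup of `n`-th powers of elements of an abelian subgroup `A`. -/
def powSubgroup (A : Subgroup G) (hA : ∀ a ∈ A, ∀ b ∈ A, a * b = b * a) (n : ℕ) : Subgroup G where
  carrier := {b | ∃ a ∈ A, a ^ n = b}
  one_mem' := ⟨1, one_mem _, one_pow _⟩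
  mul_mem' := by
    rintro _ _ ⟨a, ha, rfl⟩ ⟨b, hb, rfl⟩
    exact ⟨a * b, mul_mem ha hb, Commute.mul_pow (hA a ha b hb) n⟩
  inv_mem' := by
    rintro _ ⟨a, ha, rfl⟩
    exact ⟨a⁻¹, inv_mem ha, inv_pow a n⟩

instance (A : Subgroup G) [hAn : A.Normal] (hA : ∀ a ∈ A, ∀ b ∈ A, a * b = b * a) (n : ℕ) :
    (powSubgroup A hA n).Normal :=
  ⟨by rintro _ ⟨a, ha, rfl⟩ g; exact ⟨g * a * g⁻¹, hAn.conj_mem a ha g, conj_pow⟩⟩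

theorem commMap_pow {A : Subgroup G} [A.Normal] (hA : ∀ a ∈ A, ∀ b ∈ A, a * b = b * a) (x : G)
    {a : G} (ha : a ∈ A) (n : ℕ) : commMap x (a ^ n) = commMap x a ^ n := by
  rw [commMap_eq, commMap_eq, Commute.mul_pow, conj_pow, inv_pow]
  exact hA _ (inv_mem ha) _ (Normal.conj_mem ‹_› a ha x)

theorem iterate_commMap_pow {A : Subgroup G} [A.Normal] (hA : ∀ a ∈ A, ∀ b ∈ A, a * b = b * a)
    (x : G) {a : G} (ha : a ∈ A) (n k : ℕ) :
    (commMap x)^[k] (a ^ n) = (commMap x)^[k] a ^ n := by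
  induction k with
  | zero => rfl
  | succ k ih =>
    rw [Function.iterate_succ_apply', Function.iterate_succ_apply', ih,
      commMap_pow hA x (iterate_commMap_mem x ha k)]

/-- A finitely generated torsion-free abelian group is free, so none of its nontrivial elements is
an `n`-th power for every `n`. -/
theorem eq_one_of_forall_exists_pow_eq {A : Type*} [CommGroup A] [Group.FG A] [IsMulTorsionFree A]
    {c : A} (hc : ∀ n ≠ 0, ∃ a : A, a ^ n = c) : c = 1 := by
  have : Module.Finite ℤ (Additive A) :=
    Module.Finite.iff_addGroup_fg.mpr (GroupFG.iff_add_fg.mp inferInstance)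
  have : Module.Free ℤ (Additive A) := inferInstance
  let b := Module.Free.chooseBasis ℤ (Additive A)
  suffices Additive.ofMul c = 0 from this
  rw [← b.repr.map_eq_zero_iff]
  ext i
  rw [Finsupp.zero_apply]
  set z := b.repr (Additive.ofMul c) i with hz
  -- `z` is divisible by `|z| + 1`
  obtain ⟨a, ha⟩ := hc (z.natAbs + 1) (Nat.succ_ne_zero _)
  have h1 : z = ((z.natAbs + 1 : ℕ) : ℤ) * b.repr (Additive.ofMul a) i := by
    conv_lhs => rw [hz, ← ha, ofMul_pow, map_nsmul, Finsupp.smul_apply, nsmul_eq_mul]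
  exact Int.eq_zero_of_abs_lt_dvd ⟨_, h1⟩ (by push_cast; omega)

/-- If no `⟨x⟩ A ^ n` is nilpotent, all of them are normal and contain `[a⁻¹, x]`; since `x`
commutes with its powers, `[a⁻¹, x]` commutes with `x` up to an `n`-th power for every `n`, hence it
commutes with `x`. If some `⟨x⟩ A ^ n` is nilpotent, then `x` acts unipotently on `A ^ n`, hence
on `A`. In both cases the action of `x` on `A` is unipotent, and it is of finite order. -/
theorem _root_.IsMetaNilHamiltonian.commute_of_pow_commute (hG : IsMetaNilHamiltonian G)
    {A : Subgroup G} [A.Normal] (hA : ∀ a ∈ A, ∀ b ∈ A, a * b = b * a) (hfg : A.FG)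
    (htor : ∀ a ∈ A, ∀ n ≠ 0, a ^ n = 1 → a = 1) {x : G} {m : ℕ} (hm : m ≠ 0)
    (hx : ∀ a ∈ A, x ^ m * a = a * x ^ m) {a : G} (ha : a ∈ A) : x * a = a * x := by
  refine commute_of_pow_commute_of_engel hx (fun a ha => htor a ha m hm) ?_ ha
  clear a ha
  intro a ha
  by_cases hn : ∃ n ≠ 0, Group.IsNilpotent (zpowers x ⊔ powSubgroup A hA n : Subgroup G)
  · obtain ⟨n, hn, hnil⟩ := hn
    obtain ⟨k, hk⟩ := exists_iterate_commMap_eq_one hnil (mem_sup_left (mem_zpowers x))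
      (mem_sup_right (show a ^ n ∈ powSubgroup A hA n from ⟨a, ha, rfl⟩))
    rw [iterate_commMap_pow hA x ha] at hk
    exact ⟨k, htor _ (iterate_commMap_mem x ha k) n hn hk⟩
  · push Not at hn
    refine ⟨2, ?_⟩
    have hdiv : ∀ n ≠ 0, ∃ b ∈ A, b ^ n = (commMap x)^[2] a := by
      intro n hn0
      have hK := hG _ (hn n hn0)
      have h1 : commMap x a ∈ zpowers x ⊔ powSubgroup A hA n := by
        have hxK : x ∈ zpowers x ⊔ powSubgroup A hA n := mem_sup_left (mem_zpowers x)
        have h2 := mul_mem (hK.conj_mem x hxK a⁻¹) (inv_mem hxK)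
        rw [commMap_eq]
        simpa [mul_assoc] using h2
      obtain ⟨_, ⟨i, rfl⟩, _, ⟨b, hb, rfl⟩, h⟩ := mem_sup_of_normal_right.mp h1
      refine ⟨commMap x b, commMap_mem x hb, ?_⟩
      rw [Function.iterate_succ_apply, Function.iterate_one, ← commMap_pow hA x hb, ← h,
        commMap_eq, commMap_eq]
      group
    have : Group.FG A := (Group.fg_iff_subgroup_fg A).mpr hfg
    let _ : CommGroup A := { (inferInstance : Group A) with
      mul_comm := fun s t => Subtype.ext (hA s s.2 t t.2) }
    have : IsMulTorsionFree A := by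
      refine ⟨fun n hn s t h => ?_⟩
      have h1 : (s * t⁻¹) ^ n = 1 := by
        rw [mul_pow, inv_pow, mul_inv_eq_one]; exact h
      have h2 := htor _ (s * t⁻¹).2 n hn (congrArg Subtype.val h1)
      exact mul_inv_eq_one.mp (Subtype.ext h2)
    have hmem := iterate_commMap_mem x ha 2
    refine congrArg Subtype.val (eq_one_of_forall_exists_pow_eq (c := (⟨_, hmem⟩ : A)) ?_)
    intro n hn0
    obtain ⟨b, hb, h⟩ := hdiv n hn0
    exact ⟨⟨b, hb⟩, Subtype.ext h⟩

end AbelianNormal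

/-! ### Meta-Nil-Hamiltonian groups are finite-by-nilpotent -/

section FiniteByNilpotent

variable {G : Type*} [Group G]

/-- The centre of a nilpotent normal subgroup of finite index is a torsion-free abelian group on
which the whole group acts through a finite quotient, so it is central in the whole group. -/
theorem center_ne_bot_of_noFiniteNormal [WellFoundedGT (Subgroup G)] [Nontrivial G]
    (hG : IsMetaNilHamiltonian G) (hNF : NoFiniteNormal G) (N : Subgroup G) [N.Normal]
    [N.FiniteIndex] (hN : Group.IsNilpotent N) : center G ≠ ⊥ := by
  have hNb : N ≠ ⊥ := by
    rintro rfl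
    have : Finite G := Nat.finite_of_card_ne_zero (index_bot (G := G) ▸ FiniteIndex.index_ne_zero)
    exact top_ne_bot (hNF ⊤ inferInstance inferInstance)
  have : Nontrivial N := (nontrivial_iff_ne_bot N).mpr hNb
  let A := (center N).map N.subtype
  have hA : ∀ a ∈ A, ∀ b ∈ N, a * b = b * a := by
    rintro _ ⟨a, ha, rfl⟩ b hb
    exact (congrArg Subtype.val (mem_center_iff.mp ha ⟨b, hb⟩)).symm
  have hAN : A ≤ N := map_subtype_le _
  have hAA : ∀ a ∈ A, ∀ b ∈ A, a * b = b * a := fun a ha b hb => hA a ha b (hAN hb)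
  have hAc : A ≤ center G := by
    intro a ha
    rw [mem_center_iff]
    intro x
    obtain ⟨m, hm, -, hxm⟩ := exists_pow_mem_of_index_ne_zero (H := N) FiniteIndex.index_ne_zero x
    exact hG.commute_of_pow_commute hAA (fg_of_wellFoundedGT A)
      (fun a ha n hn h => hNF.eq_one_of_pow_eq_one hAA hn ha h) hm.ne'
      (fun a ha => (hA a ha _ hxm).symm) ha
  intro h
  have : A = ⊥ := le_bot_iff.mp (h ▸ hAc)
  rw [map_eq_bot_iff_of_injective _ N.subtype_injective] at this
  exact Group.IsNilpotent.center_ne_bot (G := N) this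

/-- Quotients of `G` without finite normal subgroups are nilpotent: such a quotient is trivial or
has a nontrivial centre, and its central quotient again has no finite normal subgroups. The maximal
condition on the kernels makes this induction terminate. -/
theorem isNilpotent_of_noFiniteNormal [WellFoundedGT (Subgroup G)] (hG : IsMetaNilHamiltonian G)
    (N : Subgroup G) [N.Normal] [N.FiniteIndex] (hN : Group.IsNilpotent N)
    {Q : Type*} [Group Q] (f : G →* Q) (hf : Function.Surjective f) (hQ : NoFiniteNormal Q) :
    Group.IsNilpotent Q := by
  induction hM : f.ker using WellFoundedGT.induction generalizing Q with
  | ind M ih =>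
    rcases subsingleton_or_nontrivial Q with hs | hs
    · infer_instance
    have := wellFoundedGT_of_surjective f hf
    have hNQ : (N.map f).Normal := Normal.map ‹_› f hf
    have hfin : (N.map f).FiniteIndex := ⟨fun h => by
      have := index_map_dvd N hf
      rw [h, zero_dvd_iff] at this
      exact FiniteIndex.index_ne_zero this⟩
    have hnil : Group.IsNilpotent (N.map f) :=
      Group.nilpotent_of_surjective (f.subgroupMap N) (f.subgroupMap_surjective N)
    have hc := center_ne_bot_of_noFiniteNormal (hG.of_surjective f hf) hQ (N.map f) hnil
    refine Group.of_quotient_center_nilpotent ?_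
    refine ih _ ?_ ((QuotientGroup.mk' (center Q)).comp f)
      ((QuotientGroup.mk'_surjective _).comp hf) hQ.quotient_center rfl
    rw [← hM, ← MonoidHom.comap_ker, QuotientGroup.ker_mk', ← MonoidHom.comap_bot]
    exact (comap_lt_comap_of_surjective hf).mpr (bot_lt_iff_ne_bot.mpr hc)

end FiniteByNilpotent

/-! ### An Engel criterion for nilpotency -/

section EngelCriterion

variable {G : Type*} [Group G]

/-- If every element of `G` acts unipotently on a nontrivial finite nilpotent normal subgroup `F`,
then `F` contains a nontrivial central element of `G`: on the `p`-torsion `V` of the centre of `F`,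
an element acting with prime order `q ≠ p` would act trivially, so `G` acts on `V` through a
`p`-group, which has a nontrivial fixed point. -/
theorem exists_mem_center_of_engel {F : Subgroup G} [hFn : F.Normal] [Finite F]
    (hF : Group.IsNilpotent F) (hbot : F ≠ ⊥)
    (hengel : ∀ x : G, ∀ a ∈ F, ∃ k, (commMap x)^[k] a = 1) :
    ∃ c ∈ F, c ≠ 1 ∧ c ∈ center G := by
  have : Nontrivial F := (nontrivial_iff_ne_bot F).mpr hbot
  have hZ : 1 < Nat.card (center F) :=
    (one_lt_card_iff_ne_bot _).mpr (Group.IsNilpotent.center_ne_bot F)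
  obtain ⟨p, hp, hpd⟩ := Nat.exists_prime_and_dvd hZ.ne'
  have : Fact p.Prime := ⟨hp⟩
  have hcomm : ∀ a ∈ (center F).map F.subtype, ∀ b ∈ F, a * b = b * a := by
    rintro _ ⟨a, ha, rfl⟩ b hb
    exact (congrArg Subtype.val (mem_center_iff.mp ha ⟨b, hb⟩)).symm
  have hle : (center F).map F.subtype ≤ F := map_subtype_le _
  have hZn : ((center F).map F.subtype).Normal := inferInstance
  let V : Subgroup G :=
    { carrier := {v | v ∈ (center F).map F.subtype ∧ v ^ p = 1}
      one_mem' := ⟨one_mem _, one_pow _⟩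
      mul_mem' := fun {s t} hs ht => ⟨mul_mem hs.1 ht.1, by
        rw [Commute.mul_pow (hcomm s hs.1 t (hle ht.1)), hs.2, ht.2, one_mul]⟩
      inv_mem' := fun {s} hs => ⟨inv_mem hs.1, by rw [inv_pow, hs.2, inv_one]⟩ }
  have hV : V.Normal :=
    ⟨fun t ht g => ⟨hZn.conj_mem t ht.1 g, by rw [conj_pow, ht.2, mul_one, mul_inv_cancel]⟩⟩
  have hVF : V ≤ F := fun v hv => hle hv.1
  have : Finite V := Finite.of_injective _ (inclusion_injective hVF)
  have hdvd : p ∣ Nat.card V := by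
    obtain ⟨z, hz⟩ := exists_prime_orderOf_dvd_card' (G := center F) p hpd
    have hzp : z ^ p = 1 := hz ▸ pow_orderOf_eq_one z
    let v : V := ⟨((z : F) : G), ⟨z, z.2, rfl⟩, congrArg (fun y : center F => ((y : F) : G)) hzp⟩
    have hv : orderOf v = p := by
      rw [← hz, ← Subgroup.orderOf_coe, ← Subgroup.orderOf_coe z, ← Subgroup.orderOf_coe (z : F)]
    exact hv ▸ orderOf_dvd_natCard v
  let φ : G →* MulAut V := MulAut.conjNormal
  have hR : IsPGroup p φ.range := by
    refine IsPGroup.of_card (n := (Nat.card φ.range).primeFactorsList.length)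
      (Nat.eq_prime_pow_of_unique_prime_dvd Nat.card_pos.ne' ?_)
    intro q hq hqd
    by_contra hqp
    have : Fact q.Prime := ⟨hq⟩
    obtain ⟨⟨_, x, rfl⟩, hr⟩ := exists_prime_orderOf_dvd_card' q hqd
    rw [← Subgroup.orderOf_coe] at hr
    change orderOf (φ x) = q at hr
    have hconj : ∀ y : G, φ y = 1 ↔ ∀ v ∈ V, y * v = v * y := by
      intro y
      constructor
      · intro h v hv
        have := congrArg Subtype.val (DFunLike.congr_fun h ⟨v, hv⟩)
        rw [MulAut.conjNormal_apply] at this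
        exact mul_inv_eq_iff_eq_mul.mp this
      · intro h
        ext v
        rw [MulAut.conjNormal_apply]
        exact mul_inv_eq_iff_eq_mul.mpr (h v v.2)
    have hxq : φ (x ^ q) = 1 := by rw [map_pow, ← hr, pow_orderOf_eq_one]
    have hx1 : φ x = 1 := (hconj x).mpr fun v hv =>
      commute_of_pow_commute_of_engel ((hconj _).mp hxq)
        (fun a ha h => by
          have h1 : a ^ Nat.gcd q p = 1 := pow_gcd_eq_one.mpr ⟨h, ha.2⟩
          rwa [(Nat.coprime_primes hq hp).mpr hqp, pow_one] at h1)
        (fun a ha => hengel x a (hVF ha)) hv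
    rw [hx1, orderOf_one] at hr
    exact hq.one_lt.ne hr
  obtain ⟨b, hb, hb1⟩ := hR.exists_fixed_point_of_prime_dvd_card_of_fixed_point V hdvd
    (a := 1) fun r => smul_one r
  refine ⟨b, hVF b.2, fun h => hb1 (Subtype.ext h.symm), mem_center_iff.mpr fun g => ?_⟩
  have := congrArg Subtype.val (hb ⟨φ g, g, rfl⟩)
  exact mul_inv_eq_iff_eq_mul.mp this

theorem map_iterate_commMap {H : Type*} [Group H] (f : G →* H) (x a : G) (k : ℕ) :
    f ((commMap x)^[k] a) = (commMap (f x))^[k] (f a) := by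
  have h : Function.Semiconj f (commMap x) (commMap (f x)) := fun a => by simp [commMap_eq]
  exact h.iterate_right k a

/-- If `G / F` is nilpotent and every element of `G` acts unipotently on the finite nilpotent normal
subgroup `F`, then `G` is nilpotent. -/
theorem isNilpotent_of_engel {F : Subgroup G} [hFn : F.Normal] [Finite F]
    (hF : Group.IsNilpotent F) {n : ℕ} (hn : (⊤ : Subgroup G).lowerCentralSeries n ≤ F)
    (hengel : ∀ x : G, ∀ a ∈ F, ∃ k, (commMap x)^[k] a = 1) : Group.IsNilpotent G := by
  obtain ⟨m, hm⟩ : ∃ m, Nat.card F = m := ⟨_, rfl⟩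
  induction m using Nat.strong_induction_on generalizing G with
  | _ m ih =>
    by_cases hbot : F = ⊥
    · exact Subgroup.nilpotent_iff_lowerCentralSeries.mpr ⟨n, le_bot_iff.mp (hbot ▸ hn)⟩
    obtain ⟨c, hcF, hc1, hc⟩ := exists_mem_center_of_engel hF hbot hengel
    let W := F ⊓ center G
    have hWn : W.Normal := inferInstance
    let f := QuotientGroup.mk' W
    have hf : Function.Surjective f := QuotientGroup.mk'_surjective W
    have hcf : f c = 1 := (QuotientGroup.eq_one_iff c).mpr ⟨hcF, hc⟩
    have hmap : (F.map f).Normal := hFn.map f hf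
    have hfin : Finite (F.map f) := Finite.of_surjective _ (f.subgroupMap_surjective F)
    have : Group.IsNilpotent (G ⧸ W) := by
      refine ih (Nat.card (F.map f)) ?_ (F := F.map f)
        (Group.nilpotent_of_surjective (f.subgroupMap F) (f.subgroupMap_surjective F))
        ?_ ?_ rfl
      · rw [← hm]
        refine lt_of_le_of_ne (Nat.card_le_card_of_surjective _ (f.subgroupMap_surjective F))
          fun h => hc1 ?_
        have hbij := (Nat.bijective_iff_surjective_and_card (f.subgroupMap F)).mpr
          ⟨f.subgroupMap_surjective F, h.symm⟩
        have h1 : (⟨c, hcF⟩ : F) = 1 := hbij.1 (Subtype.ext (by simpa using hcf))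
        exact congrArg Subtype.val h1
      · rw [← map_top_of_surjective f hf, ← map_lowerCentralSeries]
        exact map_mono hn
      · rintro q _ ⟨a, ha, rfl⟩
        obtain ⟨x, rfl⟩ := hf q
        obtain ⟨k, hk⟩ := hengel x a ha
        exact ⟨k, by rw [← map_iterate_commMap, hk, map_one]⟩
    refine Subgroup.isNilpotent_of_ker_le_center f ?_
    rw [QuotientGroup.ker_mk']
    exact inf_le_right

end EngelCriterion

/-! ### Finiteness of the commutator subgroup -/

section Commutator

variable {G : Type*} [Group G]

theorem finite_commutator_of_finite_ker {H : Type*} [Group H] (f : G →* H) [Finite f.ker]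
    [Finite (commutator H)] : Finite (commutator G) := by
  refine finite_of_finite_map f _ ?_
  have hle : (commutator G).map f ≤ commutator H := by
    rw [commutator_def, map_commutator, commutator_def]
    exact commutator_mono le_top le_top
  exact Finite.of_injective _ (inclusion_injective hle)

/-- All subgroups of the quotient by a non-nilpotent subgroup are normal. -/
theorem _root_.IsMetaNilHamiltonian.finite_commutator_quotient [Group.FG G]
    (hG : IsMetaNilHamiltonian G) (K : Subgroup G) [K.Normal] (hK : ¬ Group.IsNilpotent K) :
    Finite (commutator (G ⧸ K)) := by
  refine finite_commutator_of_forall_normal_zpowers fun q => ?_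
  have hle : K ≤ (zpowers q).comap (QuotientGroup.mk' K) := fun k hk => by
    rw [mem_comap, QuotientGroup.mk'_apply, (QuotientGroup.eq_one_iff k).mpr hk]
    exact one_mem _
  have hN := hG _ fun h => hK (isNilpotent_of_le hle h)
  rw [← map_comap_eq_self_of_surjective (QuotientGroup.mk'_surjective K) (zpowers q)]
  exact hN.map _ (QuotientGroup.mk'_surjective K)

theorem _root_.IsMetaNilHamiltonian.finite_commutator_of_finite [Group.FG G]
    (hG : IsMetaNilHamiltonian G) {K : Subgroup G} (hK : ¬ Group.IsNilpotent K) (hfin : Finite K) :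
    Finite (commutator G) := by
  have := hG K hK
  have := hG.finite_commutator_quotient K hK
  have : Finite (QuotientGroup.mk' K).ker := by rwa [QuotientGroup.ker_mk']
  exact finite_commutator_of_finite_ker (QuotientGroup.mk' K)

/-- Every `g` acts on `⟨s⟩` unipotently by nilpotency, and with finite order because the centralizer
of `s` has finite index. -/
theorem mem_center_of_normal_zpowers [hG : Group.IsNilpotent G] {s : G} (hs : (zpowers s).Normal)
    (hinf : ¬ IsOfFinOrder s) : s ∈ center G := by
  rw [mem_center_iff]
  intro g
  have := finiteIndex_centralizer_of_normal_zpowers hs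
  obtain ⟨m, hm, -, hgm⟩ :=
    exists_pow_mem_of_index_ne_zero (H := centralizer {s}) FiniteIndex.index_ne_zero g
  rw [mem_centralizer_singleton_iff] at hgm
  refine commute_of_pow_commute_of_engel (A := zpowers s) (m := m) ?_ ?_ ?_ (mem_zpowers s)
  · rintro _ ⟨i, rfl⟩
    exact (Commute.zpow_right (show Commute (g ^ m) s from hgm) i).eq
  · rintro _ ⟨i, rfl⟩ h
    have h1 : s ^ (i * (m : ℤ)) = s ^ (0 : ℤ) := by
      rw [zpow_mul, zpow_natCast, zpow_zero]; exact h
    have h2 := injective_zpow_iff_not_isOfFinOrder.mpr hinf h1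
    have h3 : i = 0 := (mul_eq_zero.mp h2).resolve_right (by exact_mod_cast hm.ne')
    simp [h3]
  · intro a _
    exact exists_iterate_commMap_eq_one (Group.isNilpotent_top.mpr hG) (mem_top g) (mem_top a)

/-- Translating `x` by an element centralizing `F` does not change its action on `F`. -/
theorem iterate_commMap_mul_of_mem_centralizer {F : Subgroup G} [F.Normal] {x z a : G}
    (hz : z ∈ centralizer (F : Set G)) (ha : a ∈ F) (k : ℕ) :
    (commMap (x * z))^[k] a = (commMap x)^[k] a := by
  induction k with
  | zero => rfl
  | succ k ih =>
    have h1 := mem_centralizer_iff.mp hz _ (iterate_commMap_mem x ha k)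
    rw [Function.iterate_succ_apply', Function.iterate_succ_apply', ih, commMap_eq, commMap_eq]
    generalize (commMap x)^[k] a = b at h1
    calc b⁻¹ * (x * z * b * (x * z)⁻¹) = b⁻¹ * (x * (z * b) * z⁻¹ * x⁻¹) := by group
      _ = b⁻¹ * (x * b * x⁻¹) := by rw [← h1]; group

theorem finiteIndex_centralizer_of_finite (F : Subgroup G) [F.Normal] [Finite F] :
    (centralizer (F : Set G)).FiniteIndex := by
  let f : G →* MulAut F := MulAut.conjNormal
  have : f.ker.FiniteIndex := finiteIndex_ker f
  refine finiteIndex_of_le (H := f.ker) fun g hg => ?_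
  rw [mem_centralizer_iff]
  intro a ha
  have h := congrArg Subtype.val (DFunLike.congr_fun (MonoidHom.mem_ker.mp hg) ⟨a, ha⟩)
  rw [MulAut.conjNormal_apply] at h
  exact (mul_inv_eq_iff_eq_mul.mp h).symm

/-- Some `x` acts non-unipotently on the finite subgroup `F`, and so do all `x * z` with `z`
centralizing `F`. Hence all `⟨x * z⟩ F` are normal, and they are infinite if `G'` is. Infinite
normal cyclic subgroups of the nilpotent group `G / F` are central, so the image of the centralizer
of `F` is central in `G / F`, and Schur's theorem applies. -/
theorem _root_.IsMetaNilHamiltonian.finite_commutator [Group.FG G] (hG : IsMetaNilHamiltonian G)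
    (hnil : ¬ Group.IsNilpotent G) (F : Subgroup G) [hFn : F.Normal] [Finite F]
    (hQ : Group.IsNilpotent (G ⧸ F)) : Finite (commutator G) := by
  by_cases hF : Group.IsNilpotent F
  swap
  · exact hG.finite_commutator_of_finite hF inferInstance
  by_contra hinf
  let f := QuotientGroup.mk' F
  have hf : Function.Surjective f := QuotientGroup.mk'_surjective F
  have hker : f.ker = F := QuotientGroup.ker_mk' F
  have hkfin : Finite f.ker := by rwa [hker]
  obtain ⟨x, a, ha, hxa⟩ : ∃ x : G, ∃ a ∈ F, ∀ k, (commMap x)^[k] a ≠ 1 := by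
    by_contra! hengel
    obtain ⟨n, hn⟩ := Subgroup.nilpotent_iff_lowerCentralSeries.mp hQ
    refine hnil (isNilpotent_of_engel hF (n := n) ?_ hengel)
    rw [← hker, ← Subgroup.map_eq_bot_iff, map_lowerCentralSeries, map_top_of_surjective f hf, hn]
  have hcenter : ∀ z ∈ centralizer (F : Set G), f (x * z) ∈ center (G ⧸ F) := by
    intro z hz
    have hK : ¬ Group.IsNilpotent (zpowers (x * z) ⊔ F : Subgroup G) := fun h => by
      obtain ⟨k, hk⟩ := exists_iterate_commMap_eq_one h (mem_sup_left (mem_zpowers (x * z)))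
        (mem_sup_right ha)
      rw [iterate_commMap_mul_of_mem_centralizer hz ha] at hk
      exact hxa k hk
    have hmap : (zpowers (x * z) ⊔ F).map f = zpowers (f (x * z)) := by
      rw [Subgroup.map_sup, MonoidHom.map_zpowers, (Subgroup.map_eq_bot_iff F).mpr hker.ge,
        sup_bot_eq]
    have hN : (zpowers (f (x * z))).Normal := hmap ▸ (hG _ hK).map f hf
    refine mem_center_of_normal_zpowers hN fun hord => hinf ?_
    refine hG.finite_commutator_of_finite hK (finite_of_finite_map f _ ?_)
    rw [hmap]
    exact (finite_zpowers.mpr hord).to_subtype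
  have hle : centralizer (F : Set G) ≤ (center (G ⧸ F)).comap f := by
    intro z hz
    have h1 := hcenter 1 (one_mem _)
    rw [mul_one] at h1
    have h2 := mul_mem (inv_mem h1) (hcenter z hz)
    rwa [← map_inv, ← map_mul, inv_mul_cancel_left] at h2
  have := finiteIndex_centralizer_of_finite F
  have hidx : ((center (G ⧸ F)).comap f).FiniteIndex := finiteIndex_of_le hle
  have : (center (G ⧸ F)).FiniteIndex :=
    ⟨index_comap_of_surjective (center (G ⧸ F)) hf ▸ hidx.index_ne_zero⟩
  have := finite_commutator_of_finiteIndex_center (G := G ⧸ F)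
  exact hinf (finite_commutator_of_finite_ker f)

end Commutator

end MetaNilHamiltonian

theorem theorem5p6 {G : Type*} [Group G] (hfg : Group.FG G)
    (hnil : ¬ Group.IsNilpotent G) (hmeta : IsMetaNilHamiltonian G)
    (H : Subgroup G) (hH : Group.IsNilpotent H) (hfin : H.FiniteIndex) :
    Group.IsSolvable G ∧ Finite (commutator G) := by
  have hN : Group.IsNilpotent H.normalCore :=
    MetaNilHamiltonian.isNilpotent_of_le H.normalCore_le hH
  constructor
  · have : Group.IsSolvable (G ⧸ H.normalCore) := MetaNilHamiltonian.isSolvable_of_finite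
      (hmeta.of_surjective _ (QuotientGroup.mk'_surjective H.normalCore))
    exact (Group.isSolvable_iff_subgroup_quotient H.normalCore).mpr ⟨inferInstance, this⟩
  · have := MetaNilHamiltonian.wellFoundedGT_of_finiteIndex H.normalCore
    obtain ⟨F, hF, hFfin, hQ⟩ :=
      MetaNilHamiltonian.exists_finite_normal_noFiniteNormal_quotient (G := G)
    exact hmeta.finite_commutator hnil F (MetaNilHamiltonian.isNilpotent_of_noFiniteNormal hmeta
      H.normalCore hN (QuotientGroup.mk' F) (QuotientGroup.mk'_surjective F) hQ)
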